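/- Let $\mathbb N=\{1,2,3,\dots\}$. For a set $X$ let $\mathcal P_f(X)$ be the collection of nonempty finite subsets of $X$, and let ${}^{\mathbb N}\mathbb N$ be the set of all functions $\mathbb N\to\mathbb N$. For nonempty finite sets $\beta,\gamma$ of positive integers write $\beta<\gamma$ if $\max\beta<\min\gamma$. A set $B\subseteq\mathbb N$ is a $J$-set if for every $F\in\mathcal P_f({}^{\mathbb N}\mathbb N)$ there are $a\in\mathbb N$ and $\beta\in\mathcal P_f(\mathbb N)$ such that $a+\sum_{t\in\beta}f(t)\in B$ for all $f\in F$. Let $\mathcal J$ be the set of all ultrafilters on $\mathbb N$ all of whose members are $J$-sets. For ultrafilters $p,q$ on $\mathbb N$ let $p+q$ be the ultrafilter with $B\in p+q$ if and only if $\{x\in\mathbb N:\{y\in\mathbb N:x+y\in B\}\in q\}\in p$; $p$ is idempotent if $p+p=p$. The tensor powers $p^{\otimes k}$, which are ultrafilters on $\mathbb N^k$, are defined by $p^{\otimes 1}=p$ and, for $B\subseteq\mathbb N^{k+1}$, $$B\in p^{\otimes(k+1)}\iff\bigl\{(x_1,\dots,x_k)\in\mathbb N^k:\{x_{k+1}\in\mathbb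 N:(x_1,\dots,x_{k+1})\in B\}\in p\bigr\}\in p^{\otimes k}.$$ **Theorem.** Let $m\in\mathbb N$ and $A\subseteq\mathbb N^m$. The following two statements are equivalent. 1. There exist functions $\alpha:\mathcal P_f({}^{\mathbb N}\mathbb N)\to\mathbb N$ and $H:\mathcal P_f({}^{\mathbb N}\mathbb N)\to\mathcal P_f(\mathbb N)$ such that (a) if $F,G\in\mathcal P_f({}^{\mathbb N}\mathbb N)$ and $F\subsetneq G$, then $\max H(F)<\min H(G)$; and (b) whenever $n\in\mathbb N$ with $n\ge m$, $G_1\subsetneq G_2\subsetneq\dots\subsetneq G_n$ are in $\mathcal P_f({}^{\mathbb N}\mathbb N)$, $\beta_1<\beta_2<\dots<\beta_m$ are nonempty subsets of $\{1,\dots,n\}$, and $f_i\in G_i$ for each $i\in\{1,\dots,n\}$, we have $$\left(\sum_{i\in\beta_1}\Bigl(\alpha(G_i)+\sum_{t\in H(G_i)}f_i(t)\Bigr),\ \dots,\ \sum_{i\in\beta_m}\Bigl(\alpha(G_i)+\sum_{t\in H(G_i)}f_i(t)\Bigr)\right)\in A.$$ 2. There exists an idempotent $p\in\mathcal J$ such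 that $A\in p^{\otimes m}$. -/

import Mathlib

namespace CentralSets

/-- `Pf X` is the collection of all nonempty finite subsets of `X`. -/
abbrev Pf (X : Type*) : Type _ := {s : Finset X // s.Nonempty}

/-- For nonempty finite subsets of a linear order, `Before β γ` means `max β < min γ`. -/
def Before {X : Type*} [LinearOrder X] (β γ : Pf X) : Prop :=
  β.1.max' β.2 < γ.1.min' γ.2

/-- The sum `∑ i ∈ s, x i` of positive integers over a nonempty finite set, as a positive integer.
(The positive integers `ℕ+` have no zero, so `Finset.sum` is not available in `ℕ+` itself.) -/
def posSum {ι : Type*} (s : Pf ι) (x : ι → ℕ+) : ℕ+ :=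
  ⟨∑ i ∈ s.1, (x i : ℕ), Finset.sum_pos (fun i _ => (x i).pos) s.2⟩

@[simp]
theorem coe_posSum {ι : Type*} (s : Pf ι) (x : ι → ℕ+) :
    (posSum s x : ℕ) = ∑ i ∈ s.1, (x i : ℕ) := rfl

/-- `J`-sets of positive integers: for every nonempty finite set `F` of sequences there are a single
`a` and a single nonempty finite `β` with `a + ∑ t ∈ β, f t ∈ A` for all `f ∈ F`. -/
def IsJSet (A : Set ℕ+) : Prop :=
  ∀ F : Pf (ℕ+ → ℕ+), ∃ (a : ℕ+) (β : Pf ℕ+), ∀ f ∈ F.1, a + posSum β f ∈ A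

/-- The set of all ultrafilters on the positive integers all of whose members are `J`-sets. -/
def ultraJ : Set (Ultrafilter ℕ+) :=
  {p | ∀ A ∈ p, IsJSet A}

/-- The tensor product `p 0 ⊗ ⋯ ⊗ p (k - 1)` of ultrafilters on `S`, an ultrafilter on `S ^ k`.
It is characterised by `mem_tensor_one` and `mem_tensor_succ` below. -/
def tensor {S : Type*} : (k : ℕ) → (Fin k → Ultrafilter S) → Ultrafilter (Fin k → S)
  | 0, _ => pure Fin.elim0
  | k + 1, p =>
    (tensor k fun i => p i.castSucc).bind fun x =>
      (p (Fin.last k)).map fun y => Fin.snoc (α := fun _ => S) x y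

theorem mem_tensor_succ {S : Type*} (k : ℕ) (p : Fin (k + 1) → Ultrafilter S)
    (A : Set (Fin (k + 1) → S)) :
    A ∈ tensor (k + 1) p ↔
      {x : Fin k → S | {y : S | Fin.snoc (α := fun _ => S) x y ∈ A} ∈ p (Fin.last k)} ∈
        tensor k fun i => p i.castSucc :=
  Iff.rfl

theorem mem_tensor_one {S : Type*} (p : Fin 1 → Ultrafilter S) (A : Set (Fin 1 → S)) :
    A ∈ tensor 1 p ↔ {y : S | (fun _ => y) ∈ A} ∈ p 0 := by
  have h : ∀ (x : Fin 0 → S) (y : S), Fin.snoc (α := fun _ => S) x y = fun _ => y := by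
    intro x y
    funext i
    obtain rfl : i = Fin.last 0 := Subsingleton.elim (α := Fin 1) i (Fin.last 0)
    exact Fin.snoc_last _ _
  rw [mem_tensor_succ]
  simp only [h]
  exact Ultrafilter.mem_pure

end CentralSets

attribute [local instance] Ultrafilter.add

/-- The addition of ultrafilters used here, written out on members. -/
theorem CentralSets.mem_add (p q : Ultrafilter ℕ+) (A : Set ℕ+) :
    A ∈ p + q ↔ {x : ℕ+ | {y : ℕ+ | x + y ∈ A} ∈ q} ∈ p :=
  Iff.rfl

open CentralSets

/-!
From `α` and `H`, the sums of terms over chains of finite sets lying strictly above `F` form a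
`J`-set, and as `F` grows these sets generate a filter which contains sums of its generic elements,
because two chains can be concatenated. Partition regularity of `J`-sets (a consequence of the
Hales–Jewett theorem) and the Ellis–Numakura lemma produce an idempotent in `ultraJ` finer than this
filter. Concatenating chains `m` times shows that its `m`-th tensor power contains `A`.

Conversely, an idempotent `p` with `A ∈ p ⊗ ⋯ ⊗ p` gives a tree of finite sequences in which
`p`-almost every element prolongs a given node and along which all tuples of `m` consecutive block
sums lie in `A`. The values of `α` and `H` at a finite set `F` are chosen by recursion on `F`: only
finitely many chains lie below `F`, so the elements prolonging all of them inside the tree form a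
member of `p`, that is, a `J`-set.
-/

namespace CentralSets

theorem mem_tensor_succ_iff_cons {S : Type*} {k : ℕ} (p : Fin (k + 1) → Ultrafilter S)
    (A : Set (Fin (k + 1) → S)) :
    A ∈ tensor (k + 1) p ↔
      {x | {y : Fin k → S | Fin.cons (α := fun _ => S) x y ∈ A} ∈ tensor k fun i => p i.succ} ∈
        p 0 := by
  induction k with
  | zero =>
    have cons_eq (x : S) : Fin.cons (α := fun _ => S) x Fin.elim0 = fun _ => x :=
      funext fun i => by rw [Fin.fin_one_eq_zero i, Fin.cons_zero]
    rw [mem_tensor_one]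
    simp only [tensor, Ultrafilter.mem_pure, Set.mem_ofPred_eq, cons_eq]
  | succ k ih =>
    rw [mem_tensor_succ, ih]
    simp only [mem_tensor_succ, Set.mem_ofPred_eq, Fin.cons_snoc_eq_snoc_cons]
    rfl

theorem eventually_forall_append_eq {S X : Type*} {p : Filter X} {L : List S}
    {P : List S → List S → X → Prop} (h : ∀ l l', l ++ l' = L → ∀ᶠ y in p, P l l' y) :
    ∀ᶠ y in p, ∀ l l', l ++ l' = L → P l l' y := by
  have h' := (Filter.eventually_all_finset (Finset.range (L.length + 1))).2 fun i _ =>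
    h _ _ (List.take_append_drop i L)
  filter_upwards [h'] with y hy l l' hl
  subst hl
  simpa using hy l.length (by simp)

section BlockSums

/-- `SumsTo l x` says that the list `l` is nonempty and has sum `x`. As a semigroup need not have a
zero, the sum is formed in `WithZero S`, where only the empty list has the sum `0`. -/
def SumsTo {S : Type*} [AddSemigroup S] (l : List S) (x : S) : Prop :=
  (l.map (↑)).sum = (x : WithZero S)

/-- The set of tuples `(x₁, …, xₘ)` such that, for some member of `T` cut into consecutive
nonempty lists `l₁ ++ ⋯ ++ lₘ`, each `xₖ` is the sum of `lₖ`. -/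
def blockSums {S : Type*} [AddSemigroup S] (m : ℕ) (T : Set (List S)) : Set (Fin m → S) :=
  {x | ∃ l : Fin m → List S, (List.ofFn l).flatten ∈ T ∧ ∀ k, SumsTo (l k) (x k)}

variable {S : Type*} [AddSemigroup S]

theorem not_sumsTo_nil (x : S) : ¬ SumsTo [] x :=
  WithZero.coe_ne_zero.symm

theorem sumsTo_singleton (x : S) : SumsTo [x] x := by
  simp [SumsTo]

theorem SumsTo.unique {l : List S} {x y : S} (hx : SumsTo l x) (hy : SumsTo l y) : x = y :=
  WithZero.coe_injective (hx.symm.trans hy)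

theorem SumsTo.append {l l' : List S} {x y : S} (hx : SumsTo l x) (hy : SumsTo l' y) :
    SumsTo (l ++ l') (x + y) := by
  rw [SumsTo, List.map_append, List.sum_append, hx, hy, WithZero.coe_add]

theorem SumsTo.eq_or_exists_of_concat {l : List S} {y z : S} (h : SumsTo (l ++ [y]) z) :
    z = y ∨ ∃ x, SumsTo l x ∧ z = x + y := by
  by_cases hl : (l.map ((↑) : S → WithZero S)).sum = 0
  · rw [SumsTo, List.map_append, List.sum_append, hl, zero_add] at h
    exact .inl (SumsTo.unique h (sumsTo_singleton y))
  · obtain ⟨x, hx⟩ := WithZero.ne_zero_iff_exists.1 hl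
    exact .inr ⟨x, hx.symm, h.unique (SumsTo.append hx.symm (sumsTo_singleton y))⟩

theorem eventually_forall_sumsTo {p : Filter S} {l : List S} {P : S → S → Prop}
    (h : ∀ x, SumsTo l x → ∀ᶠ y in p, P x y) : ∀ᶠ y in p, ∀ x, SumsTo l x → P x y :=
  (Filter.eventually_all_finite
    (Set.Subsingleton.finite (s := {x | SumsTo l x}) fun _ hx _ hy => hx.unique hy)).2 h

theorem blockSums_mono {m : ℕ} {T T' : Set (List S)} (h : T ⊆ T') :
    blockSums m T ⊆ blockSums m T' := fun _ ⟨l, hl, hx⟩ => ⟨l, h hl, hx⟩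

theorem cons_mem_blockSums_iff {m : ℕ} {T : Set (List S)} {x : S} {y : Fin m → S} :
    Fin.cons x y ∈ blockSums (m + 1) T ↔
      ∃ l, SumsTo l x ∧ y ∈ blockSums m {l' | l ++ l' ∈ T} := by
  constructor
  · rintro ⟨l, hl, hx⟩
    rw [List.ofFn_succ, List.flatten_cons] at hl
    exact ⟨l 0, hx 0, fun k => l k.succ, hl, fun k => hx k.succ⟩
  · rintro ⟨l₀, hx, l, hl, hy⟩
    refine ⟨Fin.cons l₀ l, by simpa [List.ofFn_succ] using hl, Fin.cases hx hy⟩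

theorem mem_tensor_of_blockSums_subset {p : Ultrafilter S} {m : ℕ} {T : Set (List S)}
    {A : Set (Fin m → S)} (hnil : [] ∈ T)
    (hT : ∀ l ∈ T, {x | ∃ l', SumsTo l' x ∧ l ++ l' ∈ T} ∈ p) (hA : blockSums m T ⊆ A) :
    A ∈ tensor m fun _ => p := by
  induction m generalizing T with
  | zero => exact hA ⟨Fin.elim0, hnil, fun k => k.elim0⟩
  | succ m ih =>
    rw [mem_tensor_succ_iff_cons]
    refine Filter.mem_of_superset (hT [] hnil) fun x ⟨l, hx, hl⟩ => ?_
    refine ih (T := {l' | l ++ l' ∈ T}) (by simpa using hl) (fun l' hl' => ?_)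
      fun y hy => hA (cons_mem_blockSums_iff.2 ⟨l, hx, hy⟩)
    simpa using hT (l ++ l') hl'

/-- The set `B⋆` of those `x ∈ B` with `-x + B ∈ p`. -/
def starSet (p : Ultrafilter S) (B : Set S) : Set S :=
  {x ∈ B | ∀ᶠ y in p, x + y ∈ B}

theorem starSet_mem {p : Ultrafilter S} (hp : p + p = p) {B : Set S} (hB : B ∈ p) :
    starSet p B ∈ p :=
  Filter.inter_mem hB ((Ultrafilter.eventually_add p p (· ∈ B)).1 (hp.symm ▸ hB))

theorem eventually_add_mem_starSet {p : Ultrafilter S} (hp : p + p = p) {B : Set S} {x : S}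
    (hx : x ∈ starSet p B) : ∀ᶠ y in p, x + y ∈ starSet p B := by
  filter_upwards [starSet_mem hp hx.2] with y hy
  exact ⟨hy.1, by simpa only [add_assoc, Set.mem_ofPred_eq] using hy.2⟩

/-- The lists `L` such that whenever a nonempty initial segment of `L` is cut off, its sum `x`
belongs to `B` and the rest of `L` to `T x`. -/
def graftedTree (B : Set S) (T : S → Set (List S)) : Set (List S) :=
  {L | ∀ l l' x, l ++ l' = L → SumsTo l x → x ∈ B ∧ l' ∈ T x}

theorem nil_mem_graftedTree (B : Set S) (T : S → Set (List S)) : [] ∈ graftedTree B T := by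
  intro l l' x h hx
  rw [(List.append_eq_nil_iff.1 h).1] at hx
  exact absurd hx (not_sumsTo_nil x)

theorem eventually_concat_mem_graftedTree {p : Filter S} {B : Set S} {T : S → Set (List S)}
    (hB : ∀ᶠ y in p, y ∈ B) (hadd : ∀ x ∈ B, ∀ᶠ y in p, x + y ∈ B) (hnil : ∀ x ∈ B, [] ∈ T x)
    (hT : ∀ x ∈ B, ∀ l ∈ T x, ∀ᶠ y in p, l ++ [y] ∈ T x) {L : List S}
    (hL : L ∈ graftedTree B T) : ∀ᶠ y in p, L ++ [y] ∈ graftedTree B T := by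
  have later_blocks : ∀ᶠ y in p, ∀ l l', l ++ l' = L → ∀ x, SumsTo l x → l' ++ [y] ∈ T x :=
    eventually_forall_append_eq fun l l' hl => eventually_forall_sumsTo fun x hx =>
      hT x (hL l l' x hl hx).1 l' (hL l l' x hl hx).2
  have first_block : ∀ᶠ y in p, ∀ x, SumsTo L x → x + y ∈ B :=
    eventually_forall_sumsTo fun x hx => hadd x (hL L [] x (List.append_nil L) hx).1
  filter_upwards [later_blocks, first_block, hB] with y hlater hfirst hy l l' x hl hx
  rcases List.eq_nil_or_concat' l' with rfl | ⟨l', y', rfl⟩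
  · have hxB : x ∈ B := by
      rw [List.append_nil] at hl
      rcases SumsTo.eq_or_exists_of_concat (hl ▸ hx) with rfl | ⟨x, hLx, rfl⟩
      exacts [hy, hfirst x hLx]
    exact ⟨hxB, hnil x hxB⟩
  · obtain ⟨hll', hy'⟩ := List.append_inj' ((List.append_assoc l l' _).trans hl) rfl
    obtain rfl := List.singleton_injective hy'
    exact ⟨(hL l l' x hll' hx).1, hlater l l' hll' x hx⟩

theorem exists_tree_blockSums_subset {p : Ultrafilter S} (hp : p + p = p) {m : ℕ}
    {A : Set (Fin m → S)} (hA : A ∈ tensor m fun _ => p) :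
    ∃ T : Set (List S), [] ∈ T ∧ (∀ l ∈ T, ∀ᶠ x in p, l ++ [x] ∈ T) ∧ blockSums m T ⊆ A := by
  induction m with
  | zero =>
    refine ⟨Set.univ, trivial, fun _ _ => .of_forall fun _ => trivial, fun x _ => ?_⟩
    rwa [Subsingleton.elim x Fin.elim0]
  | succ m ih =>
    let B : Set S := {x | {y | Fin.cons (α := fun _ => S) x y ∈ A} ∈ tensor m fun _ => p}
    have hB : B ∈ p := (mem_tensor_succ_iff_cons _ _).1 hA
    choose! T hTnil hTconcat hTsums using fun x (hx : x ∈ B) => ih hx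
    refine ⟨graftedTree (starSet p B) T, nil_mem_graftedTree _ _, fun L hL => ?_, fun u hu => ?_⟩
    · exact eventually_concat_mem_graftedTree (starSet_mem hp hB)
        (fun x hx => eventually_add_mem_starSet hp hx) (fun x hx => hTnil x hx.1)
        (fun x hx => hTconcat x hx.1) hL
    · rw [← Fin.cons_self_tail u] at hu ⊢
      obtain ⟨l, hl, hu'⟩ := cons_mem_blockSums_iff.1 hu
      obtain ⟨l', hl', -⟩ := id hu'
      exact hTsums _ (hl' l _ _ rfl hl).1.1
        (blockSums_mono (fun l'' h => (h l l'' _ rfl hl).2) hu')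

end BlockSums

theorem before_iff {X : Type*} [LinearOrder X] {β γ : Pf X} :
    Before β γ ↔ ∀ i ∈ β.1, ∀ j ∈ γ.1, i < j := by
  simp only [Before, Finset.max'_lt_iff, Finset.lt_min'_iff]
  exact ⟨fun h i hi j hj => h j hj i hi, fun h j hj i hi => h i hi j hj⟩

section JSets

theorem IsJSet.mono {A B : Set ℕ+} (hA : IsJSet A) (h : A ⊆ B) : IsJSet B := fun F =>
  let ⟨a, β, hβ⟩ := hA F
  ⟨a, β, fun f hf => h (hβ f hf)⟩

theorem not_isJSet_empty : ¬ IsJSet ∅ := fun h =>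
  let ⟨_, _, hβ⟩ := h ⟨{fun _ => 1}, Finset.singleton_nonempty _⟩
  hβ _ (Finset.mem_singleton_self _)

theorem IsJSet.exists_forall_before {A : Set ℕ+} (hA : IsJSet A) (F : Pf (ℕ+ → ℕ+))
    {Γ : Set (Pf ℕ+)} (hΓ : Γ.Finite) :
    ∃ (a : ℕ+) (β : Pf ℕ+), (∀ γ ∈ Γ, Before γ β) ∧ ∀ f ∈ F.1, a + posSum β f ∈ A := by
  classical
  obtain ⟨N, hN⟩ : ∃ N : ℕ+, ∀ γ ∈ Γ, ∀ t ∈ γ.1, t ≤ N :=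
    (hΓ.biUnion fun γ _ => γ.1.finite_toSet).bddAbove.imp fun N hN γ hγ t ht =>
      hN (Set.mem_biUnion hγ ht)
  obtain ⟨a, β, hβ⟩ := hA ⟨F.1.image fun f t => f (t + N), F.2.image _⟩
  refine ⟨a, ⟨β.1.map (addRightEmbedding N), β.2.map⟩, fun γ hγ => before_iff.2 fun i hi j hj => ?_,
    fun f hf => ?_⟩
  · obtain ⟨t, -, rfl⟩ := Finset.mem_map.1 hj
    exact (hN γ hγ i hi).trans_lt (PNat.lt_add_left N t)
  · convert hβ _ (Finset.mem_image_of_mem _ hf) using 2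
    apply PNat.eq
    simp

/-- The sequence whose `t`-th term adds up, over the letters of the word `w`, the terms of the
corresponding sequences at positions which `e` keeps apart for different `t` and different letters.
A variable letter of a combinatorial line thus becomes a sum over positions of its own. -/
def wordSeq {ι κ : Type*} [Fintype ι] [Nonempty ι] (e : ℕ+ × ι ↪ ℕ+) (φ : κ → ℕ+ → ℕ+)
    (w : ι → κ) (t : ℕ+) : ℕ+ :=
  posSum ⟨Finset.univ, Finset.univ_nonempty⟩ fun i => φ (w i) (e (t, i))

theorem exists_forall_posSum_wordSeq_eq {ι κ : Type*} [Fintype ι] [Nonempty ι]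
    (e : ℕ+ × ι ↪ ℕ+) (φ : κ → ℕ+ → ℕ+) (l : Combinatorics.Line κ ι) (a : ℕ+) (β : Pf ℕ+) :
    ∃ (a' : ℕ+) (γ : Pf ℕ+), ∀ x, a + posSum β (wordSeq e φ (l x)) = a' + posSum γ (φ x) := by
  classical
  let variablePart := (β.1 ×ˢ Finset.univ).filter fun ti => l.idxFun ti.2 = none
  have hvariable : variablePart.Nonempty := by
    obtain ⟨i, hi⟩ := l.proper
    obtain ⟨t, ht⟩ := β.2
    exact ⟨(t, i), by simp [variablePart, ht, hi]⟩
  let constant (ti : ℕ+ × ι) : ℕ := (l.idxFun ti.2).elim 0 fun k => φ k (e ti)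
  have split_term (x : κ) (ti : ℕ+ × ι) : (φ (l x ti.2) (e ti) : ℕ) =
      constant ti + if l.idxFun ti.2 = none then (φ x (e ti) : ℕ) else 0 := by
    cases h : l.idxFun ti.2 <;> simp [constant, h, Combinatorics.Line.coe_apply]
  obtain ⟨a', ha'⟩ : ∃ a' : ℕ+, (a' : ℕ) = a + ∑ ti ∈ β.1 ×ˢ Finset.univ, constant ti :=
    ⟨⟨_, Nat.add_pos_left a.pos _⟩, rfl⟩
  refine ⟨a', ⟨variablePart.map e, hvariable.map⟩, fun x => PNat.eq ?_⟩
  rw [PNat.add_coe, PNat.add_coe, ha']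
  simp only [coe_posSum, wordSeq, ← Finset.sum_product', Finset.sum_map,
    split_term, Finset.sum_add_distrib, Finset.sum_filter, variablePart, add_assoc]

theorem IsJSet.exists_forall_mem_or_forall_mem {A B : Set ℕ+} (h : IsJSet (A ∪ B))
    (F : Pf (ℕ+ → ℕ+)) : ∃ (a : ℕ+) (β : Pf ℕ+),
      (∀ f ∈ F.1, a + posSum β f ∈ A) ∨ ∀ f ∈ F.1, a + posSum β f ∈ B := by
  classical
  have : Nonempty F.1 := F.2.to_subtype
  obtain ⟨ι, _, hι⟩ := Combinatorics.Line.exists_mono_in_high_dimension F.1 Prop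
  have : Nonempty ι := ⟨(hι fun _ => True).choose.proper.choose⟩
  have : Countable ι := Finite.to_countable
  obtain ⟨e⟩ : Nonempty (ℕ+ × ι ≃ ℕ+) := nonempty_equiv_of_countable
  let g := wordSeq e.toEmbedding (Subtype.val : F.1 → ℕ+ → ℕ+)
  obtain ⟨a, β, hβ⟩ := h ⟨Finset.univ.image g, Finset.univ_nonempty.image g⟩
  obtain ⟨l, c, hl⟩ := hι fun w => a + posSum β (g w) ∈ A
  obtain ⟨a', γ, hγ⟩ := exists_forall_posSum_wordSeq_eq e.toEmbedding Subtype.val l a β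
  have hAB (f) (hf : f ∈ F.1) : a' + posSum γ f ∈ A ∪ B :=
    hγ ⟨f, hf⟩ ▸ hβ _ (Finset.mem_image_of_mem g (Finset.mem_univ _))
  have mem_A_iff (f) (hf : f ∈ F.1) : a' + posSum γ f ∈ A ↔ c :=
    iff_of_eq (hγ ⟨f, hf⟩ ▸ hl ⟨f, hf⟩)
  by_cases hc : c
  · exact ⟨a', γ, .inl fun f hf => (mem_A_iff f hf).2 hc⟩
  · exact ⟨a', γ, .inr fun f hf => (hAB f hf).resolve_left fun hA => hc ((mem_A_iff f hf).1 hA)⟩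

theorem IsJSet.of_union {A B : Set ℕ+} (h : IsJSet (A ∪ B)) : IsJSet A ∨ IsJSet B := by
  classical
  by_contra! hAB
  simp only [IsJSet, not_forall, not_exists] at hAB
  obtain ⟨⟨F, hF⟩, G, hG⟩ := hAB
  obtain ⟨a, β, hA | hB⟩ :=
    h.exists_forall_mem_or_forall_mem ⟨F.1 ∪ G.1, F.2.mono Finset.subset_union_left⟩
  · obtain ⟨f, hf, hfA⟩ := hF a β
    exact hfA (hA f (Finset.mem_union_left _ hf))
  · obtain ⟨g, hg, hgB⟩ := hG a β
    exact hgB (hB g (Finset.mem_union_right _ hg))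

end JSets

section Idempotents

theorem exists_ultrafilter_le_of_partitionRegular {X : Type*} {P : Set X → Prop}
    (hempty : ¬ P ∅) (hmono : ∀ s t, s ⊆ t → P s → P t) (hunion : ∀ s t, P (s ∪ t) → P s ∨ P t)
    {f : Filter X} (hf : ∀ s ∈ f, P s) : ∃ u : Ultrafilter X, ↑u ≤ f ∧ ∀ s ∈ u, P s := by
  let large : Filter X := Filter.comk (fun s => ¬ P s) hempty
    (fun t ht s hst hs => ht (hmono s t hst hs))
    (fun s hs t ht hst => (hunion s t hst).elim hs ht)
  have : (f ⊓ large).NeBot := by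
    refine Filter.inf_neBot_iff.2 fun {s} hs {t} ht => ?_
    by_contra hst
    rw [Set.not_nonempty_iff_eq_empty, ← Set.disjoint_iff_inter_eq_empty] at hst
    exact Filter.mem_comk.1 ht (hmono s _ hst.subset_compl_right (hf s hs))
  have hle := Ultrafilter.of_le (f ⊓ large)
  refine ⟨Ultrafilter.of (f ⊓ large), hle.trans inf_le_left, fun s hs => ?_⟩
  by_contra hPs
  exact Ultrafilter.compl_notMem_iff.2 hs
    (hle.trans inf_le_right (Filter.mem_comk.2 (by rwa [compl_compl])))

theorem isClosed_ultraJ : IsClosed ultraJ := by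
  have : ultraJ = ⋂ A ∈ {A | ¬ IsJSet A}, {p : Ultrafilter ℕ+ | A ∈ p}ᶜ := by
    ext p
    simp only [ultraJ, Set.mem_ofPred_eq, Set.mem_iInter, Set.mem_compl_iff]
    exact forall_congr' fun A => not_imp_not.symm
  rw [this]
  exact isClosed_biInter fun A _ => (ultrafilter_isOpen_basic A).isClosed_compl

theorem add_mem_ultraJ (p : Ultrafilter ℕ+) {q : Ultrafilter ℕ+} (hq : q ∈ ultraJ) :
    p + q ∈ ultraJ := by
  intro A hA F
  obtain ⟨x, hx⟩ := p.nonempty_of_mem ((mem_add p q A).1 hA)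
  obtain ⟨a, β, hβ⟩ := hq _ hx F
  exact ⟨x + a, β, fun f hf => by rw [add_assoc]; exact hβ f hf⟩

theorem isClosed_setOf_ultrafilter_le {X : Type*} (f : Filter X) :
    IsClosed {p : Ultrafilter X | ↑p ≤ f} := by
  simp only [Filter.le_def, Set.ofPred_forall]
  exact isClosed_biInter fun s _ => ultrafilter_isClosed_basic s

theorem exists_idempotent_mem_ultraJ {f : Filter ℕ+} (hJ : ∀ s ∈ f, IsJSet s)
    (hadd : ∀ s ∈ f, ∀ᶠ x in f, ∀ᶠ y in f, x + y ∈ s) :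
    ∃ p : Ultrafilter ℕ+, p ∈ ultraJ ∧ p + p = p ∧ ↑p ≤ f := by
  let := Ultrafilter.addSemigroup (M := ℕ+)
  obtain ⟨p₀, hp₀f, hp₀J⟩ := exists_ultrafilter_le_of_partitionRegular not_isJSet_empty
    (fun _ _ hst hs => hs.mono hst) (fun _ _ h => h.of_union) hJ
  obtain ⟨p, ⟨hpJ, hpf⟩, hp⟩ := exists_idempotent_in_compact_add_subsemigroup
    (M := Ultrafilter ℕ+) Ultrafilter.continuous_add_left (ultraJ ∩ {p | ↑p ≤ f})
    ⟨p₀, hp₀J, hp₀f⟩ (isClosed_ultraJ.inter (isClosed_setOf_ultrafilter_le f)).isCompact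
    fun p ⟨_, hpf⟩ q ⟨hqJ, hqf⟩ => ⟨add_mem_ultraJ p hqJ, fun s hs =>
      (mem_add p q s).2 (Filter.mem_of_superset (hpf (hadd s hs)) fun _ hx => hqf hx)⟩
  exact ⟨p, hpJ, hp, hpf⟩

end Idempotents

section Selection

theorem exists_forall_of_wellFoundedLT {X Y : Type*} [LT X] [WellFoundedLT X] [Nonempty Y]
    {Φ : X → (X → Y) → Y → Prop}
    (hcongr : ∀ x g g' y, (∀ x' < x, g x' = g' x') → Φ x g y → Φ x g' y)
    (hΦ : ∀ x g, ∃ y, Φ x g y) : ∃ g : X → Y, ∀ x, Φ x g (g x) := by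
  classical
  choose next hnext using hΦ
  let extend (x : X) (g : ∀ x' < x, Y) (x' : X) : Y :=
    if h : x' < x then g x' h else Classical.arbitrary Y
  let g : X → Y := wellFounded_lt.fix fun x g => next x (extend x g)
  refine ⟨g, fun x => ?_⟩
  have hg : g x = next x (extend x fun x' _ => g x') := wellFounded_lt.fix_eq _ x
  rw [hg]
  exact hcongr x _ _ _ (fun x' hx' => dif_pos hx') (hnext x _)

theorem finite_setOf_nodup_forall_mem {X : Type*} {s : Set X} (hs : s.Finite) :
    {C : List X | C.Nodup ∧ ∀ x ∈ C, x ∈ s}.Finite := by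
  have := hs.fintype
  refine (Set.finite_range fun C : {C : List s // C.Nodup} => C.1.map (↑)).subset ?_
  rintro C ⟨hC, hCs⟩
  lift C to List s using hCs
  exact ⟨⟨C, hC.of_map _⟩, rfl⟩

theorem finite_setOf_chain_lt {X : Type*} [Preorder X] {ι : X → Type*} [∀ x, Finite (ι x)] {x : X}
    (hx : (Set.Iio x).Finite) :
    {C : List (Σ x, ι x) | C.Pairwise (·.1 < ·.1) ∧ ∀ c ∈ C, c.1 < x}.Finite := by
  have finite_below : {c : Σ x, ι x | c.1 < x}.Finite := hx.preimage' fun x' _ =>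
    (Set.finite_range (Sigma.mk x')).subset <| by rintro ⟨_, i⟩ rfl; exact ⟨i, rfl⟩
  exact (finite_setOf_nodup_forall_mem finite_below).subset fun C hC =>
    ⟨hC.1.imp fun h => ne_of_apply_ne Sigma.fst h.ne, hC.2⟩

theorem exists_forall_chain_map_mem_tree {X Y S : Type*} [Preorder X] [Nonempty Y]
    (hX : ∀ x : X, (Set.Iio x).Finite) {ι : X → Type*} [∀ x, Finite (ι x)] {p : Filter S}
    {T : Set (List S)} (hnil : [] ∈ T) (hT : ∀ l ∈ T, ∀ᶠ s in p, l ++ [s] ∈ T)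
    {R : Y → Y → Prop} {w : (Σ x, ι x) → Y → S}
    (hw : ∀ x, ∀ B ∈ p, ∀ Z : Set Y, Z.Finite → ∃ y, (∀ z ∈ Z, R z y) ∧ ∀ i, w ⟨x, i⟩ y ∈ B) :
    ∃ g : X → Y, (∀ x x', x < x' → R (g x) (g x')) ∧
      ∀ C : List (Σ x, ι x), C.Pairwise (·.1 < ·.1) → C.map (fun c => w c (g c.1)) ∈ T := by
  have : WellFoundedLT X := StrictMono.wellFoundedLT (f := fun x => (Set.Iio x).ncard)
    fun x y h => Set.ncard_lt_ncard (Set.Iio_ssubset_Iio h) (hX y)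
  let values (g : X → Y) (C : List (Σ x, ι x)) : List S := C.map fun c => w c (g c.1)
  have values_congr {g g' : X → Y} {x : X} (h : ∀ x' < x, g x' = g' x')
      {C : List (Σ x, ι x)} (hC : ∀ c ∈ C, c.1 < x) : values g C = values g' C :=
    List.map_congr_left fun c hc => by rw [h c.1 (hC c hc)]
  obtain ⟨g, hg⟩ := exists_forall_of_wellFoundedLT (X := X) (Y := Y)
    (Φ := fun x g y => (∀ x' < x, R (g x') y) ∧ ∀ C : List (Σ x, ι x), C.Pairwise (·.1 < ·.1) →
      (∀ c ∈ C, c.1 < x) → values g C ∈ T → ∀ i, values g C ++ [w ⟨x, i⟩ y] ∈ T)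
    (fun x g g' y h ⟨hR, hC⟩ => ⟨fun x' hx' => h x' hx' ▸ hR x' hx', fun C hCp hCx =>
      values_congr h hCx ▸ hC C hCp hCx⟩)
    (fun x g => by
      have hB : ∀ᶠ s in p, ∀ C ∈ {C : List (Σ x, ι x) | C.Pairwise (·.1 < ·.1) ∧ ∀ c ∈ C, c.1 < x},
          values g C ∈ T → values g C ++ [s] ∈ T :=
        (Filter.eventually_all_finite (finite_setOf_chain_lt (hX x))).2 fun C _ =>
          Filter.eventually_imp_distrib_left.2 (hT _)
      obtain ⟨y, hyR, hyB⟩ := hw x _ hB _ ((hX x).image g)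
      exact ⟨y, fun x' hx' => hyR _ (Set.mem_image_of_mem g hx'), fun C hCp hCx hCT i =>
        hyB i C ⟨hCp, hCx⟩ hCT⟩)
  refine ⟨g, fun x x' h => (hg x').1 x h, fun C => ?_⟩
  induction C using List.reverseRecOn with
  | nil => exact fun _ => hnil
  | append_singleton C c ih =>
    intro hC
    obtain ⟨hC, -, hCc⟩ := List.pairwise_append.1 hC
    rw [List.map_append]
    exact (hg c.1).2 C hC (fun c' hc' => hCc c' hc' c (List.mem_singleton_self c)) (ih hC) c.2

end Selection

section Chains

instance {X : Type*} : IsDirectedOrder (Pf X) where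
  directed F G := by
    classical
    exact ⟨⟨F.1 ∪ G.1, F.2.mono Finset.subset_union_left⟩, Finset.subset_union_left,
      Finset.subset_union_right⟩

instance {X : Type*} [Infinite X] : NoMaxOrder (Pf X) where
  exists_gt F := by
    obtain ⟨x, hx⟩ := Infinite.exists_notMem_finset F.1
    exact ⟨⟨F.1.cons x hx, Finset.cons_nonempty hx⟩, Finset.ssubset_cons hx⟩

instance {X : Type*} [Nonempty X] : Nonempty (Pf X) :=
  ⟨{Classical.arbitrary X}, Finset.singleton_nonempty _⟩

theorem finite_Iio {X : Type*} (F : Pf X) : (Set.Iio F).Finite := by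
  classical
  exact (Set.finite_Iio F.1).preimage Subtype.val_injective.injOn

/-- A finite set of sequences together with a choice of one of its members. -/
abbrev Link : Type :=
  Σ F : Pf (ℕ+ → ℕ+), {f // f ∈ F.1}

/-- The term `α(G) + ∑ t ∈ H(G), f(t)` contributed by a pair `f ∈ G`. -/
def linkVal (α : Pf (ℕ+ → ℕ+) → ℕ+) (H : Pf (ℕ+ → ℕ+) → Pf ℕ+) (c : Link) : ℕ+ :=
  α c.1 + posSum (H c.1) c.2

/-- The lists of terms coming from chains `G₁ ⊂ ⋯ ⊂ Gₙ` and `fᵢ ∈ Gᵢ`. -/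
def chainLists (α : Pf (ℕ+ → ℕ+) → ℕ+) (H : Pf (ℕ+ → ℕ+) → Pf ℕ+) : Set (List ℕ+) :=
  {L | ∃ C : List Link, C.Pairwise (·.1 < ·.1) ∧ C.map (linkVal α H) = L}

/-- The sums of terms over nonempty chains all of whose members lie strictly above `F`. -/
def chainSums (α : Pf (ℕ+ → ℕ+) → ℕ+) (H : Pf (ℕ+ → ℕ+) → Pf ℕ+) (F : Pf (ℕ+ → ℕ+)) : Set ℕ+ :=
  {y | ∃ C : List Link, C.Pairwise (·.1 < ·.1) ∧ (∀ c ∈ C, F < c.1) ∧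
    SumsTo (C.map (linkVal α H)) y}

variable {α : Pf (ℕ+ → ℕ+) → ℕ+} {H : Pf (ℕ+ → ℕ+) → Pf ℕ+}

theorem exists_forall_link_le (C : List Link) : ∃ G, ∀ c ∈ C, c.1 ≤ G := by
  obtain ⟨G, hG⟩ := (C.finite_toSet.image Sigma.fst).bddAbove
  exact ⟨G, fun c hc => hG (Set.mem_image_of_mem _ hc)⟩

theorem pairwise_append_of_le_of_lt {C D : List Link} {G : Pf (ℕ+ → ℕ+)}
    (hC : C.Pairwise (·.1 < ·.1)) (hD : D.Pairwise (·.1 < ·.1)) (hCG : ∀ c ∈ C, c.1 ≤ G)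
    (hGD : ∀ d ∈ D, G < d.1) : (C ++ D).Pairwise (·.1 < ·.1) :=
  List.pairwise_append.2 ⟨hC, hD, fun c hc d hd => (hCG c hc).trans_lt (hGD d hd)⟩

theorem chainSums_antitone : Antitone (chainSums α H) :=
  fun _ _ h _ ⟨C, hC, hG, hy⟩ => ⟨C, hC, fun c hc => h.trans_lt (hG c hc), hy⟩

theorem isJSet_chainSums (F : Pf (ℕ+ → ℕ+)) : IsJSet (chainSums α H F) := by
  intro F'
  obtain ⟨G₀, hF, hF'⟩ := exists_ge_ge F F'
  obtain ⟨G, hG⟩ := exists_gt G₀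
  refine ⟨α G, H G, fun f hf => ⟨[⟨G, f, (hF'.trans hG.le) hf⟩], List.pairwise_singleton _ _,
    fun c hc => ?_, sumsTo_singleton _⟩⟩
  rw [List.mem_singleton.1 hc]
  exact hF.trans_lt hG

theorem exists_forall_add_mem_chainSums {F : Pf (ℕ+ → ℕ+)} {x : ℕ+} (hx : x ∈ chainSums α H F) :
    ∃ G, ∀ y ∈ chainSums α H G, x + y ∈ chainSums α H F := by
  obtain ⟨C, hC, hFC, hCx⟩ := hx
  obtain ⟨G₀, hG₀⟩ := exists_forall_link_le C
  obtain ⟨G, hFG, hG⟩ := exists_ge_ge F G₀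
  refine ⟨G, fun y ⟨D, hD, hGD, hDy⟩ => ⟨C ++ D,
    pairwise_append_of_le_of_lt hC hD (fun c hc => (hG₀ c hc).trans hG) hGD,
    List.forall_mem_append.2 ⟨hFC, fun d hd => hFG.trans_lt (hGD d hd)⟩, ?_⟩⟩
  rw [List.map_append]
  exact hCx.append hDy

theorem exists_idempotent_forall_chainSums_mem (α : Pf (ℕ+ → ℕ+) → ℕ+)
    (H : Pf (ℕ+ → ℕ+) → Pf ℕ+) :
    ∃ p : Ultrafilter ℕ+, p ∈ ultraJ ∧ p + p = p ∧ ∀ F, chainSums α H F ∈ p := by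
  have hbasis := Filter.hasBasis_iInf_principal
    (directed_of_isDirected_le (chainSums_antitone (α := α) (H := H)))
  obtain ⟨p, hpJ, hp, hle⟩ := exists_idempotent_mem_ultraJ
    (f := ⨅ F, Filter.principal (chainSums α H F))
    (fun s hs => by
      obtain ⟨F, -, hF⟩ := hbasis.mem_iff.1 hs
      exact (isJSet_chainSums F).mono hF)
    (fun s hs => by
      obtain ⟨F, -, hF⟩ := hbasis.mem_iff.1 hs
      filter_upwards [hbasis.mem_of_mem (i := F) trivial] with x hx
      obtain ⟨G, hG⟩ := exists_forall_add_mem_chainSums hx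
      filter_upwards [hbasis.mem_of_mem (i := G) trivial] with y hy
      exact hF (hG y hy))
  exact ⟨p, hpJ, hp, fun F => hle (hbasis.mem_of_mem trivial)⟩

theorem nil_mem_chainLists : [] ∈ chainLists α H :=
  ⟨[], List.Pairwise.nil, rfl⟩

theorem sumsTo_append_mem_chainLists_mem {p : Ultrafilter ℕ+} (hp : ∀ F, chainSums α H F ∈ p)
    {l : List ℕ+} (hl : l ∈ chainLists α H) :
    {x | ∃ l', SumsTo l' x ∧ l ++ l' ∈ chainLists α H} ∈ p := by
  obtain ⟨C, hC, rfl⟩ := hl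
  obtain ⟨G, hG⟩ := exists_forall_link_le C
  filter_upwards [hp G] with x ⟨D, hD, hGD, hDx⟩
  exact ⟨_, hDx, C ++ D, pairwise_append_of_le_of_lt hC hD hG hGD, List.map_append⟩

theorem exists_chainLists_subset {p : Ultrafilter ℕ+} (hp : p ∈ ultraJ) {T : Set (List ℕ+)}
    (hnil : [] ∈ T) (hT : ∀ l ∈ T, ∀ᶠ x in p, l ++ [x] ∈ T) :
    ∃ (α : Pf (ℕ+ → ℕ+) → ℕ+) (H : Pf (ℕ+ → ℕ+) → Pf ℕ+),
      (∀ F G, F < G → Before (H F) (H G)) ∧ chainLists α H ⊆ T := by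
  obtain ⟨g, hbefore, hg⟩ := exists_forall_chain_map_mem_tree (Y := ℕ+ × Pf ℕ+)
    (R := fun y z => Before y.2 z.2) (w := fun (c : Link) y => y.1 + posSum y.2 c.2)
    finite_Iio hnil hT fun F B hB Z hZ => by
      obtain ⟨a, β, hβ, hF⟩ := (hp B hB).exists_forall_before F (hZ.image Prod.snd)
      exact ⟨(a, β), fun z hz => hβ _ (Set.mem_image_of_mem _ hz), fun f => hF f f.2⟩
  refine ⟨fun F => (g F).1, fun F => (g F).2, hbefore, ?_⟩
  rintro _ ⟨C, hC, rfl⟩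
  exact hg C hC

end Chains

section BlocksOfIndices

theorem coe_posSum_withZero {ι : Type*} (s : Pf ι) (x : ι → ℕ+) :
    (posSum s x : WithZero ℕ+) = ∑ i ∈ s.1, (x i : WithZero ℕ+) := by
  obtain ⟨s, hs⟩ := s
  induction hs using Finset.Nonempty.cons_induction with
  | singleton i =>
    rw [Finset.sum_singleton]
    exact congrArg _ (PNat.eq (Finset.sum_singleton _ _))
  | cons i s hi hs ih =>
    rw [Finset.sum_cons, ← ih, ← WithZero.coe_add]
    exact congrArg _ (PNat.eq (Finset.sum_cons hi))

theorem sumsTo_map_posSum {ι : Type*} [DecidableEq ι] {l : List ι} (hl : l.Nodup) {s : Pf ι}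
    (hs : l.toFinset = s.1) (x : ι → ℕ+) : SumsTo (l.map x) (posSum s x) := by
  rw [SumsTo, coe_posSum_withZero, ← hs, List.sum_toFinset _ hl, List.map_map]
  rfl

theorem exists_flatten_ofFn_of_map {X Y : Type*} (g : X → Y) {m : ℕ} {l : Fin m → List Y}
    {J : List X} (h : (List.ofFn l).flatten = J.map g) :
    ∃ j : Fin m → List X, (List.ofFn j).flatten = J ∧ ∀ k, l k = (j k).map g := by
  induction m generalizing J with
  | zero => exact ⟨Fin.elim0, by simpa [eq_comm] using h, fun k => k.elim0⟩
  | succ m ih =>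
    rw [List.ofFn_succ, List.flatten_cons, List.append_eq_map_iff] at h
    obtain ⟨J₀, J', rfl, h₀, h'⟩ := h
    obtain ⟨j, rfl, hj⟩ := ih h'.symm
    exact ⟨Fin.cons J₀ j, by simp [List.ofFn_succ], Fin.cases h₀.symm hj⟩

theorem pairwise_flatten_ofFn_iff {X : Type*} {r : X → X → Prop} {m : ℕ} {j : Fin m → List X} :
    (List.ofFn j).flatten.Pairwise r ↔
      (∀ k, (j k).Pairwise r) ∧ ∀ k l, k < l → ∀ a ∈ j k, ∀ b ∈ j l, r a b := by
  rw [List.pairwise_flatten, List.forall_mem_ofFn_iff, List.pairwise_ofFn]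

theorem mem_blockSums_chainLists_iff {m : ℕ} {α : Pf (ℕ+ → ℕ+) → ℕ+} {H : Pf (ℕ+ → ℕ+) → Pf ℕ+}
    {u : Fin m → ℕ+} : u ∈ blockSums m (chainLists α H) ↔
      ∃ (n : ℕ) (c : Fin n → Link) (β : Fin m → Pf (Fin n)), (∀ i j, i < j → (c i).1 < (c j).1) ∧
        (∀ k l, k < l → Before (β k) (β l)) ∧
        u = fun k => posSum (β k) fun i => linkVal α H (c i) := by
  constructor
  · rintro ⟨l, ⟨C, hC, hCl⟩, hlu⟩
    rw [← List.map_get_finRange C, List.map_map] at hCl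
    obtain ⟨j, hj, hlj⟩ := exists_flatten_ofFn_of_map _ hCl.symm
    obtain ⟨hsorted, hlt⟩ := pairwise_flatten_ofFn_iff.1 (hj ▸ List.pairwise_lt_finRange C.length)
    have nonempty (k) : (j k).toFinset.Nonempty := by
      rw [List.toFinset_nonempty_iff]
      intro hk
      exact not_sumsTo_nil (u k) (by simpa [hlj, hk] using hlu k)
    refine ⟨C.length, C.get, fun k => ⟨(j k).toFinset, nonempty k⟩,
      List.pairwise_iff_get.1 hC, fun k l h => before_iff.2 ?_, funext fun k => ?_⟩
    · simpa using hlt k l h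
    · exact (hlj k ▸ hlu k).unique (sumsTo_map_posSum ((hsorted k).imp ne_of_lt) rfl _)
  · rintro ⟨n, c, β, hc, hβ, rfl⟩
    let j (k : Fin m) : List (Fin n) := (β k).1.sort
    have hj : (List.ofFn j).flatten.Pairwise (· < ·) := pairwise_flatten_ofFn_iff.2
      ⟨fun k => (β k).1.sortedLT_sort.pairwise, fun k l h => by
        simpa [j] using before_iff.1 (hβ k l h)⟩
    refine ⟨fun k => (j k).map (linkVal α H ∘ c), ⟨(List.ofFn j).flatten.map c, ?_, ?_⟩, fun k =>
      sumsTo_map_posSum ((β k).1.sort_nodup _) ((β k).1.sort_toFinset _) _⟩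
    · exact List.pairwise_map.2 (hj.imp (hc _ _))
    · simp [List.map_flatten, List.map_ofFn, Function.comp_def]

end BlocksOfIndices

end CentralSets

theorem theorem1p16 (m : ℕ) (hm : 1 ≤ m) (A : Set (Fin m → ℕ+)) :
    (∃ (α : Pf (ℕ+ → ℕ+) → ℕ+) (H : Pf (ℕ+ → ℕ+) → Pf ℕ+),
      (∀ F G : Pf (ℕ+ → ℕ+), F.1 ⊂ G.1 → Before (H F) (H G)) ∧
      ∀ (n : ℕ) (G : Fin n → Pf (ℕ+ → ℕ+)), (∀ i j, i < j → (G i).1 ⊂ (G j).1) →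
        ∀ β : Fin m → Pf (Fin n), (∀ k l, k < l → Before (β k) (β l)) →
          ∀ f : Fin n → (ℕ+ → ℕ+), (∀ i, f i ∈ (G i).1) →
            (fun k => posSum (β k) fun i => α (G i) + posSum (H (G i)) (f i)) ∈ A) ↔
    ∃ p : Ultrafilter ℕ+, p ∈ ultraJ ∧ p + p = p ∧ A ∈ tensor m (fun _ => p) := by
  constructor
  · rintro ⟨α, H, -, hA⟩
    obtain ⟨p, hpJ, hp, hsums⟩ := exists_idempotent_forall_chainSums_mem α H
    refine ⟨p, hpJ, hp, mem_tensor_of_blockSums_subset nil_mem_chainLists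
      (fun l hl => sumsTo_append_mem_chainLists_mem hsums hl) fun u hu => ?_⟩
    obtain ⟨n, c, β, hc, hβ, rfl⟩ := mem_blockSums_chainLists_iff.1 hu
    exact hA n (fun i => (c i).1) hc β hβ (fun i => (c i).2) fun i => (c i).2.2
  · rintro ⟨p, hpJ, hp, hA⟩
    obtain ⟨T, hnil, hT, hTA⟩ := exists_tree_blockSums_subset hp hA
    obtain ⟨α, H, hH, hαH⟩ := exists_chainLists_subset hpJ hnil hT
    exact ⟨α, H, hH, fun n G hG β hβ f hf => hTA (blockSums_mono hαH
      (mem_blockSums_chainLists_iff.2 ⟨n, fun i => ⟨G i, f i, hf i⟩, β, hG, hβ, rfl⟩))⟩
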